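/- For a finite simple undirected graph $G$ on a vertex set $V$ with $|V|=n\ge 1$, let $\bar G$ be its row-normalized adjacency matrix (rows of isolated vertices are zero). The PageRank of $G$ with damping factor $\alpha\in[0,1)$ is the row vector $$(1-\alpha)\,\mathbf v\,(1-\alpha\bar G)^{-1},\qquad \mathbf v=\tfrac1n(1,\dots,1),$$ $\ell_1$-normalized (the normalization has an effect only if $G$ has isolated vertices). PageRank with damping factor $\alpha$ is weakly score monotone on $G$ if, for every two distinct non-adjacent vertices $x,y$ of $G$, adding the edge $xy$ decreases neither the PageRank of $x$ nor that of $y$. For $k\ge 3$, let $G_k$ be the following graph with $2k+4$ vertices: take two disjoint $k$-cliques; choose a vertex $1$ in the first one and two distinct vertices $6,7$ in the second one; add new vertices $2,3,4,5$ and the edges $12,\,23,\,36,\,14,\,45$. Let $G_k'$ be obtained from $G_k$ by adding the edge between $5$ and $7$. Let $\mathrm{pre}_\alpha(5)$ and $\mathrm{post}_\alpha(5)$ be the PageRank of vertex $5$ with damping factor $\alpha$ in $G_k$ and in $G_k'$, respectively. Theorem. (i) For every $\alpha\in(0,1)$ there is a finite simple undirected graph on which PageRank with damping factor $\alpha$ is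 not weakly score monotone. (ii) More precisely, there are real sequences $(a_k)$ and $(b_k)$ with $a_k\to 0$ and $b_k\to 1$ as $k\to\infty$ such that, for all sufficiently large $k$, $0<a_k<b_k<1$ and $$\mathrm{post}_\alpha(5)-\mathrm{pre}_\alpha(5)<0\qquad\text{for all }\alpha\in[a_k,b_k].$$ In particular, for every $\alpha\in(0,1)$ and all sufficiently large $k$ (depending on $\alpha$), adding the edge between $5$ and $7$ to $G_k$ strictly decreases the PageRank of $5$. -/

import Mathlib

open Filter Topology
open scoped Matrix

/-- A centrality measure on the undirected (simple) graphs with vertex set `V`: it assigns a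
real score to every vertex of every such graph. -/
abbrev Centrality (V : Type*) := SimpleGraph V → V → ℝ

/-- `c` is weakly score monotone on `G`: for every pair of (distinct) non-adjacent vertices
`x`, `y`, adding the edge `x — y` does not decrease the score of `x` nor that of `y`. -/
def WeaklyScoreMonotoneOn {V : Type*} (c : Centrality V) (G : SimpleGraph V) : Prop :=
  ∀ x y : V, x ≠ y → ¬ G.Adj x y →
    c G x ≤ c (G ⊔ SimpleGraph.edge x y) x ∧ c G y ≤ c (G ⊔ SimpleGraph.edge x y) y

open Classical in
/-- The row-normalized adjacency matrix of `G`; the rows of isolated vertices are null. -/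
noncomputable def transitionMatrix {V : Type*} [Fintype V] (G : SimpleGraph V) : Matrix V V ℝ :=
  fun x y => if G.Adj x y then 1 / (G.degree x : ℝ) else 0

/-- The row vector `(1 - α) v (1 - α Ḡ)⁻¹`, with `v` the uniform preference vector and `Ḡ` the
row-normalized adjacency matrix. -/
noncomputable def dampedRanking {V : Type*} [Fintype V] [DecidableEq V] (α : ℝ)
    (G : SimpleGraph V) : V → ℝ :=
  (1 - α) • ((fun _ => 1 / (Fintype.card V : ℝ)) ᵥ* (1 - α • transitionMatrix G)⁻¹)

/-- PageRank with damping factor `α` and uniform preference vector: the vector `dampedRanking`,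
normalized to have sum one. (For `0 ≤ α < 1` its entries are nonnegative, so this is
`ℓ₁`-normalization; it changes nothing when `G` has no isolated vertex.) -/
noncomputable def pageRank {V : Type*} [Fintype V] [DecidableEq V] (α : ℝ) : Centrality V :=
  fun G x => dampedRanking α G x / ∑ y, dampedRanking α G y

/-- The matrix inverted in the definition of PageRank is invertible for every damping factor
in `[0, 1)`. -/
theorem isUnit_det_one_sub_smul_transitionMatrix {V : Type*} [Fintype V] [DecidableEq V]
    {α : ℝ} (h0 : 0 ≤ α) (h1 : α < 1) (G : SimpleGraph V) :
    IsUnit (1 - α • transitionMatrix G).det := by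
  classical
  refine isUnit_iff_ne_zero.mpr (det_ne_zero_of_sum_row_lt_diag fun x => ?_)
  have hd : (1 - α • transitionMatrix G) x x = 1 := by
    simp [transitionMatrix]
  have hs : ∑ y, transitionMatrix G x y ≤ 1 := by
    have : ∑ y, transitionMatrix G x y = (G.degree x : ℝ) * (1 / (G.degree x : ℝ)) := by
      simp only [transitionMatrix]
      rw [← Finset.sum_filter, Finset.sum_const, nsmul_eq_mul, ← SimpleGraph.card_neighborFinset_eq_degree,
        SimpleGraph.neighborFinset_eq_filter]
    rw [this, mul_one_div]
    exact div_self_le_one _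
  have hn : ∀ y, 0 ≤ transitionMatrix G x y := fun y => by
    simp only [transitionMatrix]; split_ifs <;> positivity
  rw [hd, norm_one]
  calc ∑ y ∈ Finset.univ.erase x, ‖(1 - α • transitionMatrix G) x y‖
      = ∑ y ∈ Finset.univ.erase x, α * transitionMatrix G x y := by
        refine Finset.sum_congr rfl fun y hy => ?_
        have hxy : x ≠ y := (Finset.ne_of_mem_erase hy).symm
        simp [Matrix.sub_apply, Matrix.one_apply_ne hxy, abs_of_nonneg h0, abs_of_nonneg (hn y)]
    _ ≤ ∑ y, α * transitionMatrix G x y :=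
        Finset.sum_le_sum_of_subset_of_nonneg (Finset.erase_subset _ _)
          fun y _ _ => mul_nonneg h0 (hn y)
    _ = α * ∑ y, transitionMatrix G x y := by rw [Finset.mul_sum]
    _ ≤ α * 1 := mul_le_mul_of_nonneg_left hs h0
    _ < 1 := by linarith

/-- The number of vertices of the counterexample graph carrying each of the labels `0, …, 8`. -/
def labelMult (k : ℕ) : Fin 9 → ℕ := ![k - 1, 1, 1, 1, 1, 1, 1, 1, k - 2]

/-- The vertices of the counterexample graph: `⟨j, i⟩` is the `i`-th vertex with label `j`. -/
abbrev CexVertex (k : ℕ) : Type := Σ j : Fin 9, Fin (labelMult k j)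

/-- The unordered pairs of labels (each listed once) carried by adjacent vertices. -/
def cexLabelPairs : Finset (Fin 9 × Fin 9) :=
  {(0, 0), (0, 1), (1, 2), (2, 3), (3, 6), (1, 4), (4, 5), (6, 7), (6, 8), (7, 8), (8, 8)}

/-- The counterexample graph (for `k ≥ 3`): two `k`-cliques, one formed by the vertices labelled
`0` (`k - 1` of them) and `1`, the other by those labelled `6`, `7` and `8` (`k - 2` of them),
joined by the path `1 — 2 — 3 — 6`, together with a pendant path `1 — 4 — 5`. -/
def cexGraph (k : ℕ) : SimpleGraph (CexVertex k) :=
  SimpleGraph.fromRel fun u v => (u.1, v.1) ∈ cexLabelPairs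

/-- The only vertex labelled `5`. -/
def node5 (k : ℕ) : CexVertex k := ⟨5, (0 : Fin 1)⟩

/-- The only vertex labelled `7`. -/
def node7 (k : ℕ) : CexVertex k := ⟨7, (0 : Fin 1)⟩

/-! ### The PageRank equation, comparison with supersolutions, and the general decrease criterion.
-/

section PageRankEquation

/-! There are no isolated vertices, so PageRank is the solution of r(x) = β + α ∑_{y ~ x}
r(y)/deg(y), with β = (1 - α)/n. Before the edge is added, 5 is a leaf and returns its whole score
to 4, which sends half back: the loop 4-5 alone gives r(5) ≥ β(1 + α/2)/(1 - α²/2). Afterwards 5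
returns only half, so r(5) ≤ (β + αt)(1 + α/2)/(1 - α²/4), where t bounds what 1 and 7 send along
one edge. The new edge thus weakens the loop by a fixed factor, and 5 loses as soon as t is small
enough. Smallness of t comes from large degrees (`dampedRanking_le_of_degree`): a clique vertex
spreads its score over at least k - 1 edges. Comparison with a supersolution proportional to the
degree, with a small factor s off the path vertices 2, 3, 4, 5, gives t = s/n with s of order 1/((1
- α)k). `pageRank_lt_of_extend_pendant_path` combines the bounds into a condition that here reads 20
< α(1 - α)²(k - 1); it holds on intervals of α that exhaust (0, 1). -/

theorem lt_of_path_bounds {α s n p q : ℝ} (h0 : 0 < α) (h1 : α < 1) (hs0 : 0 < s)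
    (hs : 4 * s < α * (1 - α)) (hn : 0 < n)
    (hp : (1 - α) / n * (1 + α / 2) ≤ p * (1 - α ^ 2 / 2))
    (hq : q * (1 - α ^ 2 / 4) ≤ ((1 - α) / n + α * (s / n)) * (1 + α / 2)) : q < p := by
  have hA : 0 < 1 - α ^ 2 / 2 := by nlinarith
  have hB : 0 < 1 - α ^ 2 / 4 := by nlinarith
  -- The gap between the loop factors is α²/4, so αs < (1 - α)α²/4 suffices; this is where the 4 in
  -- `hs` comes from.
  have hlt : (1 - α + α * s) * (1 - α ^ 2 / 2) < (1 - α) * (1 - α ^ 2 / 4) := by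
    nlinarith [mul_lt_mul_of_pos_left hs h0, mul_pos (mul_pos h0 hs0) (pow_pos h0 2)]
  have hlt' : ((1 - α) / n + α * (s / n)) * (1 + α / 2) * (1 - α ^ 2 / 2)
      < (1 - α) / n * (1 + α / 2) * (1 - α ^ 2 / 4) := by
    have hc : 0 < (1 + α / 2) / n := by positivity
    calc _ = (1 + α / 2) / n * ((1 - α + α * s) * (1 - α ^ 2 / 2)) := by ring
      _ < (1 + α / 2) / n * ((1 - α) * (1 - α ^ 2 / 4)) := mul_lt_mul_of_pos_left hlt hc
      _ = _ := by ring
  have h2 := mul_le_mul_of_nonneg_right hp hB.le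
  have h3 := mul_le_mul_of_nonneg_right hq hA.le
  refine lt_of_mul_lt_mul_right ?_ (mul_pos hA hB).le
  linarith

variable {V : Type*} [Fintype V]

theorem transitionMatrix_nonneg (G : SimpleGraph V) (x y : V) : 0 ≤ transitionMatrix G x y := by
  simp only [transitionMatrix]; split_ifs <;> positivity

open Classical in
theorem sum_transitionMatrix (G : SimpleGraph V) (x : V) :
    ∑ y, transitionMatrix G x y = (G.degree x : ℝ) / (G.degree x : ℝ) := by
  simp only [transitionMatrix]
  rw [← Finset.sum_filter, Finset.sum_const, nsmul_eq_mul,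
    ← SimpleGraph.card_neighborFinset_eq_degree, SimpleGraph.neighborFinset_eq_filter, mul_one_div]

theorem sum_transitionMatrix_le_one (G : SimpleGraph V) (x : V) :
    ∑ y, transitionMatrix G x y ≤ 1 := by
  rw [sum_transitionMatrix]
  exact div_self_le_one _

/-- A vector `w` with `α w Ḡ ≤ w` is nonnegative. -/
theorem nonneg_of_smul_vecMul_le {α : ℝ} (h0 : 0 ≤ α) (h1 : α < 1) (G : SimpleGraph V)
    (w : V → ℝ) (hw : ∀ x, α * ∑ y, w y * transitionMatrix G y x ≤ w x) (x : V) : 0 ≤ w x := by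
  -- The negative part of w satisfies the reverse inequality. Summing over x, with row sums at most
  -- 1, bounds its total mass by α times itself, so it vanishes.
  have hneg : ∀ x, max (-w x) 0 ≤ α * ∑ y, max (-w y) 0 * transitionMatrix G y x := by
    intro x
    refine max_le ?_ (mul_nonneg h0 (Finset.sum_nonneg fun y _ =>
      mul_nonneg (le_max_right _ _) (transitionMatrix_nonneg G y x)))
    calc -w x ≤ α * ∑ y, (-w y) * transitionMatrix G y x := by
          have := hw x
          simp only [neg_mul, Finset.sum_neg_distrib]
          linarith
      _ ≤ _ := mul_le_mul_of_nonneg_left (Finset.sum_le_sum fun y _ =>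
          mul_le_mul_of_nonneg_right (le_max_left _ _) (transitionMatrix_nonneg G y x)) h0
  have hsum : ∑ x, max (-w x) 0 ≤ α * ∑ x, max (-w x) 0 :=
    calc ∑ x, max (-w x) 0
        ≤ ∑ x, α * ∑ y, max (-w y) 0 * transitionMatrix G y x :=
          Finset.sum_le_sum fun x _ => hneg x
      _ = α * ∑ y, max (-w y) 0 * ∑ x, transitionMatrix G y x := by
          rw [← Finset.mul_sum, Finset.sum_comm]
          simp only [Finset.mul_sum]
      _ ≤ α * ∑ y, max (-w y) 0 := by
          refine mul_le_mul_of_nonneg_left (Finset.sum_le_sum fun y _ => ?_) h0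
          exact mul_le_of_le_one_right (le_max_right _ _) (sum_transitionMatrix_le_one G y)
  have hle : max (-w x) 0 ≤ ∑ x, max (-w x) 0 :=
    Finset.single_le_sum (f := fun x => max (-w x) 0) (fun y _ => le_max_right _ _)
      (Finset.mem_univ x)
  have : -w x ≤ max (-w x) 0 := le_max_left _ _
  nlinarith

open Classical in
theorem sum_mul_transitionMatrix (G : SimpleGraph V) (h : V → ℝ) (x : V) :
    ∑ y, h y * transitionMatrix G y x = ∑ y ∈ G.neighborFinset x, h y / (G.degree y : ℝ) := by
  rw [SimpleGraph.neighborFinset_eq_filter, Finset.sum_filter]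
  refine Finset.sum_congr rfl fun y _ => ?_
  simp only [transitionMatrix, G.adj_comm x y]
  split_ifs <;> simp [div_eq_mul_inv]

variable [DecidableEq V]

theorem dampedRanking_apply {α : ℝ} (h0 : 0 ≤ α) (h1 : α < 1) (G : SimpleGraph V) (x : V) :
    dampedRanking α G x = (1 - α) / (Fintype.card V : ℝ)
      + α * ∑ y, dampedRanking α G y * transitionMatrix G y x := by
  have h : dampedRanking α G ᵥ* (1 - α • transitionMatrix G)
      = (1 - α) • fun _ => 1 / (Fintype.card V : ℝ) := by
    rw [dampedRanking, Matrix.smul_vecMul, Matrix.vecMul_vecMul, Matrix.nonsing_inv_mul _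
      (isUnit_det_one_sub_smul_transitionMatrix h0 h1 G), Matrix.vecMul_one]
  have hx := congrFun h x
  rw [Matrix.vecMul_sub, Matrix.vecMul_one, Matrix.vecMul_smul] at hx
  simp only [Pi.sub_apply, Pi.smul_apply, smul_eq_mul, Matrix.vecMul, dotProduct] at hx
  rw [div_eq_mul_one_div]
  linarith

theorem dampedRanking_nonneg {α : ℝ} (h0 : 0 ≤ α) (h1 : α < 1) (G : SimpleGraph V) (x : V) :
    0 ≤ dampedRanking α G x := by
  refine nonneg_of_smul_vecMul_le h0 h1 G _ (fun x => ?_) x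
  have : 0 ≤ (1 - α) / (Fintype.card V : ℝ) := div_nonneg (by linarith) (Nat.cast_nonneg _)
  have := dampedRanking_apply h0 h1 G x
  linarith

/-- Comparison principle: the constant term cancels in the difference between a supersolution and
the solution, leaving the hypothesis of `nonneg_of_smul_vecMul_le`. -/
theorem dampedRanking_le {α : ℝ} (h0 : 0 ≤ α) (h1 : α < 1) (G : SimpleGraph V) (h : V → ℝ)
    (hh : ∀ x, (1 - α) / (Fintype.card V : ℝ) + α * ∑ y, h y * transitionMatrix G y x ≤ h x)
    (x : V) : dampedRanking α G x ≤ h x := by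
  refine sub_nonneg.1 (nonneg_of_smul_vecMul_le h0 h1 G
    (fun x => h x - dampedRanking α G x) (fun x => ?_) x)
  have := dampedRanking_apply h0 h1 G x
  have := hh x
  simp only [sub_mul, Finset.sum_sub_distrib]
  linarith

open Classical in
theorem dampedRanking_eq_sum_neighborFinset {α : ℝ} (h0 : 0 ≤ α) (h1 : α < 1)
    (G : SimpleGraph V) (x : V) :
    dampedRanking α G x = (1 - α) / (Fintype.card V : ℝ)
      + α * ∑ y ∈ G.neighborFinset x, dampedRanking α G y / (G.degree y : ℝ) := by
  rw [← sum_mul_transitionMatrix]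
  exact dampedRanking_apply h0 h1 G x

open Classical in
theorem sum_dampedRanking [Nonempty V] {α : ℝ} (h0 : 0 ≤ α) (h1 : α < 1) (G : SimpleGraph V)
    (hG : ∀ x, 0 < G.degree x) : ∑ x, dampedRanking α G x = 1 := by
  have h : ∑ x, dampedRanking α G x = (1 - α) + α * ∑ x, dampedRanking α G x := by
    conv_lhs => rw [Finset.sum_congr rfl fun x _ => dampedRanking_apply h0 h1 G x]
    rw [Finset.sum_add_distrib, Finset.sum_const, ← Finset.mul_sum, Finset.sum_comm]
    simp only [← Finset.mul_sum, nsmul_eq_mul, Finset.card_univ]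
    congr 1
    · field_simp
    · congr 1
      refine Finset.sum_congr rfl fun x _ => ?_
      rw [sum_transitionMatrix, div_self (Nat.cast_ne_zero.2 (hG x).ne'), mul_one]
  have h' : (1 - α) * (∑ x, dampedRanking α G x - 1) = 0 := by linarith
  rcases mul_eq_zero.1 h' with h' | h' <;> linarith

open Classical in
theorem pageRank_eq_dampedRanking [Nonempty V] {α : ℝ} (h0 : 0 ≤ α) (h1 : α < 1)
    (G : SimpleGraph V) (hG : ∀ x, 0 < G.degree x) : pageRank α G = dampedRanking α G := by
  funext x
  rw [pageRank, sum_dampedRanking h0 h1 G hG, div_one]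

open Classical in
/-- If the vertices outside a set `P` have large degree, their damped ranking divided by their
degree is small. -/
theorem dampedRanking_le_of_degree {α : ℝ} (h0 : 0 ≤ α) (h1 : α < 1) (G : SimpleGraph V)
    (hG : ∀ x, 0 < G.degree x) (P : Finset V) {s : ℝ} (hs0 : 0 ≤ s) (hs1 : s ≤ 1)
    (hP : ∀ x ∉ P, 1 + (P.card : ℝ) ≤ (1 - α) * (s * G.degree x)) (x : V) :
    dampedRanking α G x ≤
      (G.degree x : ℝ) * (if x ∈ P then 1 else s) / (Fintype.card V : ℝ) := by
  refine dampedRanking_le h0 h1 G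
    (fun x => (G.degree x : ℝ) * (if x ∈ P then 1 else s) / (Fintype.card V : ℝ)) (fun x => ?_) x
  -- The degree factor cancels the row normalization, so each neighbor contributes only its weight 1
  -- or s.
  have hsum : ∑ y, (G.degree y : ℝ) * (if y ∈ P then 1 else s) / (Fintype.card V : ℝ)
      * transitionMatrix G y x
      = (∑ y ∈ G.neighborFinset x, if y ∈ P then 1 else s) / (Fintype.card V : ℝ) := by
    rw [sum_mul_transitionMatrix, Finset.sum_div]
    refine Finset.sum_congr rfl fun y _ => ?_
    have : (G.degree y : ℝ) ≠ 0 := Nat.cast_ne_zero.2 (hG y).ne'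
    field_simp
  rw [hsum, ← mul_div_assoc, ← add_div]
  refine div_le_div_of_nonneg_right ?_ (Nat.cast_nonneg _)
  have hd : (1 : ℝ) ≤ G.degree x := by exact_mod_cast hG x
  by_cases hx : x ∈ P
  · have hle : (∑ y ∈ G.neighborFinset x, if y ∈ P then (1 : ℝ) else s) ≤ G.degree x := by
      rw [← SimpleGraph.card_neighborFinset_eq_degree, ← nsmul_one]
      exact Finset.sum_le_card_nsmul _ _ _ fun y _ => by split_ifs <;> linarith
    rw [if_pos hx]
    nlinarith
  · have hle : (∑ y ∈ G.neighborFinset x, if y ∈ P then (1 : ℝ) else s)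
        ≤ G.degree x * s + P.card := by
      calc (∑ y ∈ G.neighborFinset x, if y ∈ P then (1 : ℝ) else s)
          ≤ ∑ y ∈ G.neighborFinset x, (s + if y ∈ P then 1 else 0) :=
            Finset.sum_le_sum fun y _ => by split_ifs <;> linarith
        _ = G.degree x * s + ((G.neighborFinset x).filter (· ∈ P)).card := by
            rw [Finset.sum_add_distrib, Finset.sum_const, Finset.sum_boole, nsmul_eq_mul,
              SimpleGraph.card_neighborFinset_eq_degree]
        _ ≤ _ := by
            gcongr
            intro y hy
            exact (Finset.mem_filter.1 hy).2
    rw [if_neg hx]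
    have := hP x hx
    have hc : (0 : ℝ) ≤ P.card := Nat.cast_nonneg _
    nlinarith

open Classical in
/-- Lower bound at the endpoint `c` of a pendant path `a — b — c`. -/
theorem le_dampedRanking_of_pendant_path {α : ℝ} (h0 : 0 ≤ α) (h1 : α < 1) (G : SimpleGraph V)
    {a b c : V} (hac : a ≠ c) (hb : G.neighborFinset b = {a, c}) (hc : G.neighborFinset c = {b}) :
    (1 - α) / (Fintype.card V : ℝ) * (1 + α / 2) ≤ dampedRanking α G c * (1 - α ^ 2 / 2) := by
  have eb := dampedRanking_eq_sum_neighborFinset h0 h1 G b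
  have ec := dampedRanking_eq_sum_neighborFinset h0 h1 G c
  have db : G.degree b = 2 := by
    rw [← SimpleGraph.card_neighborFinset_eq_degree, hb, Finset.card_pair hac]
  have dc : G.degree c = 1 := by
    rw [← SimpleGraph.card_neighborFinset_eq_degree, hc, Finset.card_singleton]
  rw [hb, Finset.sum_pair hac, dc] at eb
  rw [hc, Finset.sum_singleton, db] at ec
  -- The inflow from a is simply dropped; only the loop b-c is kept.
  have ha : 0 ≤ α * (dampedRanking α G a / (G.degree a : ℝ)) :=
    mul_nonneg h0 (div_nonneg (dampedRanking_nonneg h0 h1 G a) (Nat.cast_nonneg _))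
  push_cast at eb ec
  rw [div_one, mul_add] at eb
  nlinarith [mul_nonneg h0 ha]

open Classical in
/-- Upper bound at the vertex `c` of an induced path `a — b — c — d` whose inner vertices have
degree two. -/
theorem dampedRanking_le_of_path {α : ℝ} (h0 : 0 ≤ α) (h1 : α < 1) (G : SimpleGraph V)
    {a b c d : V} (hac : a ≠ c) (hbd : b ≠ d) (hb : G.neighborFinset b = {a, c})
    (hc : G.neighborFinset c = {b, d}) {t : ℝ}
    (ha : dampedRanking α G a / (G.degree a : ℝ) ≤ t)
    (hd : dampedRanking α G d / (G.degree d : ℝ) ≤ t) :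
    dampedRanking α G c * (1 - α ^ 2 / 4)
      ≤ ((1 - α) / (Fintype.card V : ℝ) + α * t) * (1 + α / 2) := by
  have eb := dampedRanking_eq_sum_neighborFinset h0 h1 G b
  have ec := dampedRanking_eq_sum_neighborFinset h0 h1 G c
  have db : G.degree b = 2 := by
    rw [← SimpleGraph.card_neighborFinset_eq_degree, hb, Finset.card_pair hac]
  have dc : G.degree c = 2 := by
    rw [← SimpleGraph.card_neighborFinset_eq_degree, hc, Finset.card_pair hbd]
  rw [hb, Finset.sum_pair hac, dc] at eb
  rw [hc, Finset.sum_pair hbd, db] at ec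
  push_cast at eb ec
  rw [mul_add] at eb ec
  have ha' := mul_le_mul_of_nonneg_left ha h0
  have hd' := mul_le_mul_of_nonneg_left hd h0
  nlinarith [mul_le_mul_of_nonneg_left ha' h0]

open Classical in
/-- Joining the endpoint `c` of a pendant path `a — b — c` to a vertex `d` decreases the PageRank
of `c` when all vertices outside a small set `P`, among them `a` and `d`, have large degree. -/
theorem pageRank_lt_of_extend_pendant_path {α : ℝ} (h0 : 0 < α) (h1 : α < 1)
    {G G' : SimpleGraph V} (hGG' : G ≤ G') (hG : ∀ x, 0 < G.degree x) (P : Finset V) {m : ℝ}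
    (hm : 0 < m) (hP : ∀ x ∉ P, m ≤ G.degree x) (hPm : 4 * (1 + P.card) < α * (1 - α) ^ 2 * m)
    {a b c d : V} (ha : a ∉ P) (hd : d ∉ P) (hac : a ≠ c) (hbd : b ≠ d)
    (hb : ∀ v, G.Adj b v ↔ v = a ∨ v = c) (hc : ∀ v, G.Adj c v ↔ v = b)
    (hb' : ∀ v, G'.Adj b v ↔ v = a ∨ v = c) (hc' : ∀ v, G'.Adj c v ↔ v = b ∨ v = d) :
    pageRank α G' c < pageRank α G c := by
  have : Nonempty V := ⟨a⟩
  have hmono : ∀ v, G.degree v ≤ G'.degree v := fun v => SimpleGraph.degree_le_of_le hGG'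
  have hpos' : ∀ v, 0 < G'.degree v := fun v => (hG v).trans_le (hmono v)
  rw [pageRank_eq_dampedRanking h0.le h1 G hG, pageRank_eq_dampedRanking h0.le h1 G' hpos']
  have hn : (0 : ℝ) < Fintype.card V := Nat.cast_pos.2 Fintype.card_pos
  have hα : 0 < 1 - α := by linarith
  -- The least s meeting the hypothesis of `dampedRanking_le_of_degree` at degree m; `hPm` then says
  -- exactly 4s < α(1 - α).
  obtain ⟨s, hs⟩ : ∃ s : ℝ, s = (1 + P.card) / ((1 - α) * m) := ⟨_, rfl⟩
  have hs0 : 0 < s := hs ▸ by positivity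
  have hsm : (1 - α) * (s * m) = 1 + P.card := by rw [hs]; field_simp
  have hs4 : 4 * s < α * (1 - α) := by
    rw [hs, mul_div_assoc', div_lt_iff₀ (by positivity)]
    linarith
  have hs1 : s ≤ 1 := by nlinarith
  have hbound : ∀ v ∉ P, dampedRanking α G' v / (G'.degree v : ℝ) ≤ s / Fintype.card V := by
    intro v hv
    have hdeg : (0 : ℝ) < G'.degree v := Nat.cast_pos.2 (hpos' v)
    have hle := dampedRanking_le_of_degree h0.le h1 G' hpos' P hs0.le hs1 (fun x hx => ?_) v
    · rw [if_neg hv] at hle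
      rw [div_le_iff₀ hdeg]
      refine hle.trans_eq ?_
      ring
    · have hx' : m ≤ G'.degree x := (hP x hx).trans (Nat.cast_le.2 (hmono x))
      rw [← hsm]
      gcongr
  exact lt_of_path_bounds h0 h1 hs0 hs4 hn
    (le_dampedRanking_of_pendant_path h0.le h1 G (b := b) hac (by ext; simp [hb]) (by ext; simp [hc]))
    (dampedRanking_le_of_path h0.le h1 G' hac hbd (by ext; simp [hb']) (by ext; simp [hc'])
      (hbound a ha) (hbound d hd))

end PageRankEquation

/-! ### Invariance of PageRank under relabelling, to move the counterexample to `Fin n`. -/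

section Relabelling

variable {V W : Type*} [Fintype V] [Fintype W]

theorem transitionMatrix_comap (e : W ≃ V) (G : SimpleGraph V) :
    transitionMatrix (G.comap e) = (transitionMatrix G).submatrix e e := by
  classical
  ext x y
  have hd : (G.comap e).degree x = G.degree (e x) :=
    ((SimpleGraph.Iso.comap e G).degree_eq x).symm
  simp only [transitionMatrix, Matrix.submatrix_apply, SimpleGraph.comap_adj]
  split_ifs
  · convert congrArg (fun n : ℕ => 1 / (n : ℝ)) hd
  · rfl

variable [DecidableEq V] [DecidableEq W]

theorem dampedRanking_comap (α : ℝ) (e : W ≃ V) (G : SimpleGraph V) (x : W) :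
    dampedRanking α (G.comap e) x = dampedRanking α G (e x) := by
  have h : (1 - α • transitionMatrix (G.comap e))⁻¹
      = ((1 - α • transitionMatrix G)⁻¹).submatrix e e := by
    rw [transitionMatrix_comap, ← Matrix.inv_submatrix_equiv, Matrix.submatrix_sub,
      Matrix.submatrix_smul]
    simp
  simp only [dampedRanking, h, Fintype.card_congr e, Pi.smul_apply, Matrix.vecMul, dotProduct,
    Matrix.submatrix_apply]
  congr 1
  exact e.sum_comp fun y => 1 / (Fintype.card V : ℝ) * (1 - α • transitionMatrix G)⁻¹ y (e x)

theorem pageRank_comap (α : ℝ) (e : W ≃ V) (G : SimpleGraph V) (x : W) :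
    pageRank α (G.comap e) x = pageRank α G (e x) := by
  simp only [pageRank, dampedRanking_comap]
  rw [e.sum_comp fun y => dampedRanking α G y]

theorem weaklyScoreMonotoneOn_of_comap (α : ℝ) (e : W ≃ V) (G : SimpleGraph V)
    (h : WeaklyScoreMonotoneOn (pageRank α) (G.comap e)) :
    WeaklyScoreMonotoneOn (pageRank α) G := by
  intro x y hxy hadj
  have key := h (e.symm x) (e.symm y) (e.symm.injective.ne hxy) (by simpa using hadj)
  have hG : G.comap e ⊔ SimpleGraph.edge (e.symm x) (e.symm y)
      = (G ⊔ SimpleGraph.edge x y).comap e := by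
    ext u v
    simp [SimpleGraph.edge_adj, Equiv.eq_symm_apply]
  simpa [hG, pageRank_comap] using key

end Relabelling

/-! ### Adjacency and degrees in the counterexample graph, and the range of damping factors. -/

section Counterexample

theorem cexGraph_adj {k : ℕ} {u v : CexVertex k} : (cexGraph k).Adj u v ↔
    u ≠ v ∧ ((u.1, v.1) ∈ cexLabelPairs ∨ (v.1, u.1) ∈ cexLabelPairs) :=
  SimpleGraph.fromRel_adj _ _ _

def node1 (k : ℕ) : CexVertex k := ⟨1, (0 : Fin 1)⟩

def node4 (k : ℕ) : CexVertex k := ⟨4, (0 : Fin 1)⟩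

theorem eq_of_label_eq {k : ℕ} {u v : CexVertex k} (h : u.1 = v.1) (hv : labelMult k v.1 = 1) :
    u = v := by
  obtain ⟨i, a⟩ := u
  obtain ⟨j, b⟩ := v
  dsimp only at h hv
  subst h
  congr 1
  apply Fin.ext
  omega

theorem node_ne {k : ℕ} {u v : CexVertex k} (h : u.1 ≠ v.1) : u ≠ v :=
  fun e => h (congrArg Sigma.fst e)

theorem cexGraph_node4_adj {k : ℕ} {v : CexVertex k} :
    (cexGraph k).Adj (node4 k) v ↔ v = node1 k ∨ v = node5 k := by
  have hlab : (((4 : Fin 9), v.1) ∈ cexLabelPairs ∨ (v.1, (4 : Fin 9)) ∈ cexLabelPairs) ↔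
      v.1 = 1 ∨ v.1 = 5 := by
    -- Adjacency depends on the labels apart from distinctness, so the check is finite and
    -- independent of k.
    generalize v.1 = j
    revert j
    decide
  rw [cexGraph_adj]
  refine ⟨fun h => (hlab.1 h.2).imp (fun h => eq_of_label_eq h rfl)
    fun h => eq_of_label_eq h rfl, ?_⟩
  rintro (rfl | rfl)
  · exact ⟨node_ne (show (4 : Fin 9) ≠ 1 by decide), hlab.2 (Or.inl rfl)⟩
  · exact ⟨node_ne (show (4 : Fin 9) ≠ 5 by decide), hlab.2 (Or.inr rfl)⟩

theorem cexGraph_node5_adj {k : ℕ} {v : CexVertex k} :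
    (cexGraph k).Adj (node5 k) v ↔ v = node4 k := by
  have hlab : (((5 : Fin 9), v.1) ∈ cexLabelPairs ∨ (v.1, (5 : Fin 9)) ∈ cexLabelPairs) ↔
      v.1 = 4 := by
    generalize v.1 = j
    revert j
    decide
  rw [cexGraph_adj]
  refine ⟨fun h => eq_of_label_eq (hlab.1 h.2) rfl, ?_⟩
  rintro rfl
  exact ⟨node_ne (show (5 : Fin 9) ≠ 4 by decide), hlab.2 rfl⟩

theorem cexGraph_sup_edge_node4_adj {k : ℕ} {v : CexVertex k} :
    (cexGraph k ⊔ SimpleGraph.edge (node5 k) (node7 k)).Adj (node4 k) v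
      ↔ v = node1 k ∨ v = node5 k := by
  rw [← cexGraph_node4_adj]
  have h5 : node4 k ≠ node5 k := node_ne (show (4 : Fin 9) ≠ 5 by decide)
  have h7 : node4 k ≠ node7 k := node_ne (show (4 : Fin 9) ≠ 7 by decide)
  simp [SimpleGraph.edge_adj, h5, h7]

theorem cexGraph_sup_edge_node5_adj {k : ℕ} {v : CexVertex k} :
    (cexGraph k ⊔ SimpleGraph.edge (node5 k) (node7 k)).Adj (node5 k) v
      ↔ v = node4 k ∨ v = node7 k := by
  have h7 : node5 k ≠ node7 k := node_ne (show (5 : Fin 9) ≠ 7 by decide)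
  rw [SimpleGraph.sup_adj, cexGraph_node5_adj, SimpleGraph.edge_adj]
  constructor
  · rintro (h | ⟨⟨-, h⟩ | ⟨h, -⟩, -⟩)
    · exact Or.inl h
    · exact Or.inr h
    · exact absurd h h7
  · rintro (h | rfl)
    · exact Or.inl h
    · exact Or.inr ⟨Or.inl ⟨rfl, rfl⟩, h7⟩

/-- The vertices labelled `2`, `3`, `4`, `5`. -/
def pathVertices (k : ℕ) : Finset (CexVertex k) :=
  ({2, 3, 4, 5} : Finset (Fin 9)).sigma fun _ => Finset.univ

theorem mem_pathVertices {k : ℕ} {v : CexVertex k} :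
    v ∈ pathVertices k ↔ v.1 ∈ ({2, 3, 4, 5} : Finset (Fin 9)) := by
  simp [pathVertices]

theorem card_pathVertices (k : ℕ) : (pathVertices k).card = 4 := by
  rw [pathVertices, Finset.card_sigma]
  simp only [Finset.card_univ, Fintype.card_fin]
  rfl

open Classical in
-- The vertices with labels in S form a clique: a label pair missing from the list is allowed only
-- on the diagonal at 1, 6 or 7, labels carried by a single vertex. The -1 removes v itself.
theorem le_degree_of_clique {k m : ℕ} (S : Finset (Fin 9)) {v : CexVertex k} (hv : v.1 ∈ S)
    (hS : ∀ i ∈ S, ∀ j ∈ S, ((i, j) ∈ cexLabelPairs ∨ (j, i) ∈ cexLabelPairs) ∨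
      i = j ∧ j ∈ ({1, 6, 7} : Finset (Fin 9)))
    (hm : ∑ j ∈ S, labelMult k j = m) : m - 1 ≤ (cexGraph k).degree v := by
  have hcard : (S.sigma fun j => (Finset.univ : Finset (Fin (labelMult k j)))).card = m := by
    rw [Finset.card_sigma, ← hm]
    simp
  rw [← hcard, ← SimpleGraph.card_neighborFinset_eq_degree]
  refine Finset.pred_card_le_card_erase.trans (Finset.card_le_card (s := Finset.erase _ v) ?_)
  intro u hu
  obtain ⟨huv, hu⟩ := Finset.mem_erase.1 hu
  rw [SimpleGraph.mem_neighborFinset, cexGraph_adj]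
  refine ⟨huv.symm, (hS _ hv _ (Finset.mem_sigma.1 hu).1).resolve_right fun h => ?_⟩
  refine huv.symm (eq_of_label_eq h.1 ?_)
  have h := h.2
  simp only [Finset.mem_insert, Finset.mem_singleton] at h
  rcases h with h | h | h <;> rw [h] <;> rfl

open Classical in
theorem le_degree_of_notMem_pathVertices {k : ℕ} (hk : 3 ≤ k) {v : CexVertex k}
    (hv : v ∉ pathVertices k) : k - 1 ≤ (cexGraph k).degree v := by
  have hlab : v.1 ∈ ({0, 1} : Finset (Fin 9)) ∨ v.1 ∈ ({6, 7, 8} : Finset (Fin 9)) := by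
    rw [mem_pathVertices] at hv
    revert hv
    generalize v.1 = j
    revert j
    decide
  rcases hlab with h | h
  · refine le_degree_of_clique _ h (by decide) ?_
    simp [labelMult]
    omega
  · refine le_degree_of_clique _ h (by decide) ?_
    simp [labelMult]
    omega

open Classical in
theorem degree_cexGraph_pos {k : ℕ} (hk : 3 ≤ k) (v : CexVertex k) :
    0 < (cexGraph k).degree v := by
  by_cases hv : v ∈ pathVertices k
  · rw [SimpleGraph.degree_pos_iff_exists_adj]
    -- Path vertices pair up as 2-3 and 4-5, so a neighbor exists whose label has multiplicity 1.
    have hlab : ∃ j : Fin 9, j ≠ v.1 ∧ j ∈ ({2, 3, 4, 5} : Finset (Fin 9)) ∧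
        ((v.1, j) ∈ cexLabelPairs ∨ (j, v.1) ∈ cexLabelPairs) := by
      rw [mem_pathVertices] at hv
      revert hv
      generalize v.1 = j
      revert j
      decide
    obtain ⟨j, hne, hj, hadj⟩ := hlab
    have hpos : 0 < labelMult k j := by
      simp only [Finset.mem_insert, Finset.mem_singleton] at hj
      rcases hj with rfl | rfl | rfl | rfl <;> exact Nat.one_pos
    exact ⟨⟨j, ⟨0, hpos⟩⟩, cexGraph_adj.2 ⟨node_ne hne.symm, hadj⟩⟩
  · have := le_degree_of_notMem_pathVertices hk hv
    omega

theorem pageRank_node5_lt {k : ℕ} (hk : 3 ≤ k) {α : ℝ} (h0 : 0 < α) (h1 : α < 1)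
    (h : 20 < α * (1 - α) ^ 2 * (k - 1)) :
    pageRank α (cexGraph k ⊔ SimpleGraph.edge (node5 k) (node7 k)) (node5 k)
      < pageRank α (cexGraph k) (node5 k) := by
  have h1P : node1 k ∉ pathVertices k := fun h => absurd (mem_pathVertices.1 h)
    (show (1 : Fin 9) ∉ ({2, 3, 4, 5} : Finset (Fin 9)) by decide)
  have h7P : node7 k ∉ pathVertices k := fun h => absurd (mem_pathVertices.1 h)
    (show (7 : Fin 9) ∉ ({2, 3, 4, 5} : Finset (Fin 9)) by decide)
  have hk1 : (1 : ℝ) < k := by exact_mod_cast (by omega : 1 < k)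
  refine pageRank_lt_of_extend_pendant_path h0 h1 le_sup_left (degree_cexGraph_pos hk)
    (pathVertices k) (sub_pos.2 hk1) (fun v hv => ?_)
    (by rw [card_pathVertices]; push_cast; linarith) h1P h7P
    (node_ne (show (1 : Fin 9) ≠ 5 by decide)) (node_ne (show (4 : Fin 9) ≠ 7 by decide))
    (fun _ => cexGraph_node4_adj) (fun _ => cexGraph_node5_adj)
    (fun _ => cexGraph_sup_edge_node4_adj) (fun _ => cexGraph_sup_edge_node5_adj)
  have := Nat.sub_le_iff_le_add.1 (le_degree_of_notMem_pathVertices hk hv)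
  rw [sub_le_iff_le_add]
  exact_mod_cast this

theorem not_weaklyScoreMonotoneOn_cexGraph {k : ℕ} {α : ℝ}
    (h : pageRank α (cexGraph k ⊔ SimpleGraph.edge (node5 k) (node7 k)) (node5 k)
      < pageRank α (cexGraph k) (node5 k)) :
    ¬ WeaklyScoreMonotoneOn (pageRank α) (cexGraph k) := by
  intro hG
  refine h.not_ge (hG (node5 k) (node7 k) (node_ne (show (5 : Fin 9) ≠ 7 by decide)) fun hadj => ?_).1
  exact absurd (cexGraph_adj.1 hadj).2 (by
    change ¬(((5 : Fin 9), (7 : Fin 9)) ∈ cexLabelPairs ∨ ((7 : Fin 9), (5 : Fin 9)) ∈ cexLabelPairs)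
    decide)

theorem exists_damping_interval : ∃ a b : ℕ → ℝ, Tendsto a atTop (𝓝 0) ∧ Tendsto b atTop (𝓝 1) ∧
    ∀ᶠ k : ℕ in atTop, 0 < a k ∧ a k < b k ∧ b k < 1 ∧
      ∀ α ∈ Set.Icc (a k) (b k),
        pageRank α (cexGraph k ⊔ SimpleGraph.edge (node5 k) (node7 k)) (node5 k)
          < pageRank α (cexGraph k) (node5 k) := by
  have ha : Tendsto (fun k : ℕ => (k : ℝ) ^ (-(1 / 4) : ℝ)) atTop (𝓝 0) :=
    (tendsto_rpow_neg_atTop (by norm_num)).comp tendsto_natCast_atTop_atTop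
  -- With ε = k^(-1/4), α(1 - α)² ≥ ε³ on [ε, 1 - ε], and ε³k = 1/ε tends to infinity; any exponent
  -- strictly between -1/3 and 0 would do.
  refine ⟨fun k => (k : ℝ) ^ (-(1 / 4) : ℝ), fun k => 1 - (k : ℝ) ^ (-(1 / 4) : ℝ), ha, ?_, ?_⟩
  · simpa using ha.const_sub 1
  · filter_upwards [ha.eventually_lt_const (by norm_num : (0 : ℝ) < 1 / 40), eventually_ge_atTop 3]
      with k hsmall hk
    have hk0 : (0 : ℝ) < k := by
      have : (3 : ℝ) ≤ k := by exact_mod_cast hk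
      linarith
    have hpos : 0 < (k : ℝ) ^ (-(1 / 4) : ℝ) := Real.rpow_pos_of_pos hk0 _
    have hpow : ((k : ℝ) ^ (-(1 / 4) : ℝ)) ^ 4 * k = 1 := by
      rw [← Real.rpow_natCast, ← Real.rpow_mul hk0.le]
      norm_num
      rw [Real.rpow_neg_one, inv_mul_cancel₀ hk0.ne']
    generalize (k : ℝ) ^ (-(1 / 4) : ℝ) = ε at hsmall hpos hpow
    refine ⟨hpos, by linarith, by linarith, fun α hα => ?_⟩
    have hε : ε ≤ 1 - α := by linarith [hα.2]
    have hα0 : 0 < α := hpos.trans_le hα.1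
    refine pageRank_node5_lt hk hα0 (by linarith) ?_
    have hk3 : (3 : ℝ) ≤ k := by exact_mod_cast hk
    have hcube : ε ^ 3 ≤ α * (1 - α) ^ 2 := by
      calc ε ^ 3 = ε * ε ^ 2 := by ring
        _ ≤ _ := mul_le_mul hα.1 (pow_le_pow_left₀ hpos.le hε 2) (by positivity) hα0.le
    -- From ε⁴k = 1 and ε < 1/40; replacing k by k - 1 costs at most ε³ ≤ 1, so 20 is still
    -- exceeded.
    have h40 : 40 ≤ ε ^ 3 * k := by
      have : 0 < ε ^ 3 * k := by positivity
      nlinarith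
    have hε3 : ε ^ 3 ≤ 1 := pow_le_one₀ hpos.le (by linarith)
    calc (20 : ℝ) < ε ^ 3 * (k - 1) := by linarith
      _ ≤ _ := mul_le_mul_of_nonneg_right hcube (by linarith)

end Counterexample

theorem mainTheorem2 :
    (∀ α : ℝ, 0 < α → α < 1 →
      ∃ (n : ℕ) (G : SimpleGraph (Fin n)), ¬ WeaklyScoreMonotoneOn (pageRank α) G) ∧
    ∃ a b : ℕ → ℝ, Tendsto a atTop (𝓝 0) ∧ Tendsto b atTop (𝓝 1) ∧
      ∀ᶠ k : ℕ in atTop, 0 < a k ∧ a k < b k ∧ b k < 1 ∧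
        ∀ α ∈ Set.Icc (a k) (b k),
          pageRank α (cexGraph k ⊔ SimpleGraph.edge (node5 k) (node7 k)) (node5 k)
            < pageRank α (cexGraph k) (node5 k) := by
  refine ⟨fun α h0 h1 => ?_, exists_damping_interval⟩
  obtain ⟨a, b, ha, hb, hab⟩ := exists_damping_interval
  obtain ⟨k, hk, hak, hbk⟩ := (hab.and ((ha.eventually_lt_const h0).and
    (hb.eventually_const_lt h1))).exists
  have hlt := hk.2.2.2 α ⟨hak.le, hbk.le⟩
  let e := (Fintype.equivFin (CexVertex k)).symm
  exact ⟨_, (cexGraph k).comap e, fun h =>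
    not_weaklyScoreMonotoneOn_cexGraph hlt (weaklyScoreMonotoneOn_of_comap α e _ h)⟩
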